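/- Let $d\ge 1$. Let $A:\mathbb R^d\to\mathbb R^d$ be an expansive dilation, i.e. a linear map with $A(\mathbb Z^d)\subseteq\mathbb Z^d$ all of whose complex eigenvalues have modulus $>1$; let $A^*$ be its adjoint and $\mathcal D_Af(x)=|\det A|^{1/2}f(Ax)$ the associated unitary operator on $L^2(\mathbb R^d)$. Let $G\subseteq\mathbb R^d$ be a (Lebesgue) measurable set with $A^*G=G$, and let $$H^2_G=\{f\in L^2(\mathbb R^d):\ \widehat f(\xi)=0\text{ for a.e. }\xi\notin G\},\qquad \widehat f(\xi)=\int_{\mathbb R^d} f(x)e^{-2\pi i x\cdot\xi}\,dx .$$ Let $W\subseteq L^2(\mathbb R^d)$ be a shift-invariant subspace (a closed subspace such that $f(\cdot-k)\in W$ for all $f\in W$, $k\in\mathbb Z^d$) with $$H^2_G=\bigoplus_{j\in\mathbb Z}\mathcal D_A^jW ,$$ that is, the subspaces $\mathcal D_A^jW$, $j\in\mathbb Z$, are mutually orthogonal and the closure of their linear span is $H^2_G$. A family $\{\phi^\alpha\}_{\alpha\in I}\subseteq W$ is a tight frame generator of $W$ if $\sum_{\alpha\in I}\sum_{k\in\mathbb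 Z^d}|\langle f,\phi^\alpha(\cdot-k)\rangle|^2=\|f\|^2$ for all $f\in W$. A spectral function of $W$ is a function $\sigma_W$ such that, for some tight frame generator of $W$, the series $\sum_{\alpha\in I}|\widehat{\phi^\alpha}(\xi)|^2$ converges to $\sigma_W(\xi)$ for a.e. $\xi\in\mathbb R^d$. Then $W$ has a spectral function, and for every spectral function $\sigma_W$ of $W$ the origin is a point of $A^*$-approximate continuity of $\sigma_W$ once we set $\sigma_W(0)=0$. That is, after this modification at the origin there is a measurable set $E\subseteq\mathbb R^d$ of positive measure such that, with $B_r$ the open ball of radius $r$ around the origin, $$\lim_{j\to\infty}\frac{|E\cap (A^*)^{-j}B_r|}{|(A^*)^{-j}B_r|}=1\ \text{ for all } r>0,\qquad\text{and}\qquad \lim_{\substack{\xi\to0\\ \xi\in E}}\sigma_W(\xi)=\sigma_W(0)=0 .$$ -/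

import Mathlib

open MeasureTheory Filter Topology
open scoped FourierTransform ENNReal

namespace ShiftInvariant

/-- `ℝ^d` with its Euclidean structure. -/
abbrev Rd (d : ℕ) : Type := EuclideanSpace ℝ (Fin d)

/-- The complex Hilbert space `L²(ℝ^d)` (Lebesgue measure). -/
abbrev L2 (d : ℕ) : Type := Lp ℂ 2 (volume : Measure (Rd d))

/-- A point of the lattice `ℤ^d`, seen in `ℝ^d`. -/
def latticePoint {d : ℕ} (k : Fin d → ℤ) : Rd d := WithLp.toLp 2 fun i => (k i : ℝ)

/-- Translation by a lattice point: `(translate k f)(x) = f (x - k)`. -/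
noncomputable def translate {d : ℕ} (k : Fin d → ℤ) : L2 d →ₗᵢ[ℂ] L2 d :=
  Lp.compMeasurePreservingₗᵢ ℂ (fun x : Rd d => x - latticePoint k)
    (measurePreserving_sub_right volume (latticePoint k))

/-- A shift-invariant subspace of `L²(ℝ^d)`: a closed subspace that is stable under the
translations `f ↦ f (· - k)`, `k ∈ ℤ^d`. -/
structure IsShiftInvariant {d : ℕ} (V : Submodule ℂ (L2 d)) : Prop where
  isClosed : IsClosed (V : Set (L2 d))
  translate_mem : ∀ f ∈ V, ∀ k : Fin d → ℤ, translate k f ∈ V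

/-- An expansive dilation: a linear map with `A ℤ^d ⊆ ℤ^d` all of whose complex eigenvalues
(the complex roots of its characteristic polynomial) have modulus `> 1`. -/
structure IsExpansiveDilation {d : ℕ} (A : Rd d →ₗ[ℝ] Rd d) : Prop where
  map_lattice : ∀ k : Fin d → ℤ, ∃ m : Fin d → ℤ, A (latticePoint k) = latticePoint m
  one_lt_norm : ∀ z : ℂ, (A.charpoly.map (algebraMap ℝ ℂ)).IsRoot z → 1 < ‖z‖

theorem IsExpansiveDilation.det_ne_zero {d : ℕ} {A : Rd d →ₗ[ℝ] Rd d}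
    (hA : IsExpansiveDilation A) : LinearMap.det A ≠ 0 := by
  intro h
  have h0 : (A.charpoly.map (algebraMap ℝ ℂ)).IsRoot 0 := by
    have h1 : A.charpoly.coeff 0 = 0 := by
      have h2 := LinearMap.det_eq_sign_charpoly_coeff A
      rw [h] at h2
      rcases mul_eq_zero.mp h2.symm with h3 | h3
      · exact absurd h3 (pow_ne_zero _ (by norm_num))
      · exact h3
    rw [Polynomial.IsRoot.def, ← Polynomial.coeff_zero_eq_eval_zero, Polynomial.coeff_map, h1,
      map_zero]
  have := hA.one_lt_norm 0 h0
  norm_num at this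

section Dilation

variable {d : ℕ}

theorem map_volume_linearMap {A : Rd d →ₗ[ℝ] Rd d} (hA : LinearMap.det A ≠ 0) :
    Measure.map A (volume : Measure (Rd d)) =
      ENNReal.ofReal |(LinearMap.det A)⁻¹| • (volume : Measure (Rd d)) :=
  Measure.map_linearMap_addHaar_eq_smul_addHaar volume hA

theorem quasiMeasurePreserving_linearMap {A : Rd d →ₗ[ℝ] Rd d} (hA : LinearMap.det A ≠ 0) :
    Measure.QuasiMeasurePreserving A (volume : Measure (Rd d)) volume := by
  refine ⟨A.continuous_of_finiteDimensional.measurable, ?_⟩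
  rw [map_volume_linearMap hA]
  exact Measure.smul_absolutelyContinuous

theorem eLpNorm_comp_linearMap {A : Rd d →ₗ[ℝ] Rd d} (hA : LinearMap.det A ≠ 0) (f : L2 d) :
    eLpNorm (f ∘ A) 2 volume =
      ENNReal.ofReal (Real.sqrt |LinearMap.det A|)⁻¹ * eLpNorm f 2 volume := by
  have hmeas : Measurable A := A.continuous_of_finiteDimensional.measurable
  have haes : AEStronglyMeasurable f (Measure.map A (volume : Measure (Rd d))) := by
    rw [map_volume_linearMap hA]
    exact (Lp.aestronglyMeasurable f).smul_measure _
  have h5 : ENNReal.ofReal |(LinearMap.det A)⁻¹| ^ (1 / (2 : ℝ≥0∞)).toReal =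
      ENNReal.ofReal (Real.sqrt |LinearMap.det A|)⁻¹ := by
    rw [ENNReal.ofReal_rpow_of_nonneg (abs_nonneg _) (by simp), abs_inv, ← Real.sqrt_inv,
      Real.sqrt_eq_rpow]
    simp
  rw [← eLpNorm_map_measure haes hmeas.aemeasurable, map_volume_linearMap hA,
    eLpNorm_smul_measure_of_ne_top (by norm_num), smul_eq_mul, h5]

theorem eLpNorm_dilation {A : Rd d →ₗ[ℝ] Rd d} (hA : LinearMap.det A ≠ 0) (f : L2 d) :
    eLpNorm (fun x => ((Real.sqrt |LinearMap.det A| : ℝ) : ℂ) * f (A x)) 2 volume =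
      eLpNorm f 2 volume := by
  have hpos : 0 < |LinearMap.det A| := abs_pos.mpr hA
  have h3 : eLpNorm (((Real.sqrt |LinearMap.det A| : ℝ) : ℂ) • (f ∘ A)) 2 volume =
      ‖((Real.sqrt |LinearMap.det A| : ℝ) : ℂ)‖ₑ * eLpNorm (f ∘ A) 2 volume :=
    eLpNorm_const_smul _ _ _ _
  have h4 : ‖((Real.sqrt |LinearMap.det A| : ℝ) : ℂ)‖ₑ =
      ENNReal.ofReal (Real.sqrt |LinearMap.det A|) := by
    rw [← ofReal_norm, Complex.norm_real, Real.norm_of_nonneg (Real.sqrt_nonneg _)]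
  have h6 : ENNReal.ofReal (Real.sqrt |LinearMap.det A|) *
      ENNReal.ofReal (Real.sqrt |LinearMap.det A|)⁻¹ = 1 := by
    rw [← ENNReal.ofReal_mul (Real.sqrt_nonneg _),
      mul_inv_cancel₀ (Real.sqrt_pos.mpr hpos).ne', ENNReal.ofReal_one]
  change eLpNorm (((Real.sqrt |LinearMap.det A| : ℝ) : ℂ) • (f ∘ A)) 2 volume = _
  rw [h3, eLpNorm_comp_linearMap hA, h4, ← mul_assoc, h6, one_mul]

theorem memLp_dilation {A : Rd d →ₗ[ℝ] Rd d} (hA : LinearMap.det A ≠ 0) (f : L2 d) :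
    MemLp (fun x => ((Real.sqrt |LinearMap.det A| : ℝ) : ℂ) * f (A x)) 2 volume := by
  refine ⟨?_, ?_⟩
  · exact ((Lp.aestronglyMeasurable f).comp_quasiMeasurePreserving
      (quasiMeasurePreserving_linearMap hA)).const_mul _
  · rw [eLpNorm_dilation hA]
    exact Lp.eLpNorm_lt_top f

/-- The dilation operator `f ↦ |det A|^{1/2} f (A ·)` of an invertible linear map `A`, as a linear
isometry of `L²(ℝ^d)`. -/
noncomputable def dilationIsometry (A : Rd d →ₗ[ℝ] Rd d) (hA : LinearMap.det A ≠ 0) :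
    L2 d →ₗᵢ[ℂ] L2 d where
  toFun f := (memLp_dilation hA f).toLp
    (fun x => ((Real.sqrt |LinearMap.det A| : ℝ) : ℂ) * f (A x))
  map_add' f g := by
    rw [← MemLp.toLp_add, MemLp.toLp_eq_toLp_iff]
    filter_upwards [(quasiMeasurePreserving_linearMap hA).ae (Lp.coeFn_add f g)] with x hx
    simp only [Pi.add_apply] at hx ⊢
    rw [hx, mul_add]
  map_smul' c f := by
    rw [RingHom.id_apply, ← MemLp.toLp_const_smul, MemLp.toLp_eq_toLp_iff]
    filter_upwards [(quasiMeasurePreserving_linearMap hA).ae (Lp.coeFn_smul c f)] with x hx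
    simp only [Pi.smul_apply, smul_eq_mul] at hx ⊢
    rw [hx]
    ring
  norm_map' f := by
    change ‖(memLp_dilation hA f).toLp _‖ = ‖f‖
    rw [Lp.norm_toLp, eLpNorm_dilation hA, Lp.norm_def]

theorem dilationIsometry_apply_ae (A : Rd d →ₗ[ℝ] Rd d) (hA : LinearMap.det A ≠ 0) (f : L2 d) :
    ∀ᵐ x, dilationIsometry A hA f x = ((Real.sqrt |LinearMap.det A| : ℝ) : ℂ) * f (A x) :=
  MemLp.coeFn_toLp (memLp_dilation hA f)

theorem dilationIsometry_surjective (A : Rd d →ₗ[ℝ] Rd d) (hA : LinearMap.det A ≠ 0) :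
    Function.Surjective (dilationIsometry A hA) := by
  intro g
  set e := A.equivOfDetNeZero hA with he
  have heA : ∀ x, e x = A x := fun x => rfl
  set B : Rd d →ₗ[ℝ] Rd d := e.symm.toLinearMap with hB
  have hBA : ∀ x, B (A x) = x := fun x => by
    rw [← heA]; exact e.symm_apply_apply x
  have hdet : LinearMap.det B * LinearMap.det A = 1 := by
    rw [← LinearMap.det_comp]
    have : B ∘ₗ A = LinearMap.id := LinearMap.ext hBA
    rw [this, LinearMap.det_id]
  have hBdet : LinearMap.det B ≠ 0 := left_ne_zero_of_mul_eq_one hdet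
  refine ⟨dilationIsometry B hBdet g, ?_⟩
  apply Lp.ext
  filter_upwards [dilationIsometry_apply_ae A hA (dilationIsometry B hBdet g),
    (quasiMeasurePreserving_linearMap hA).ae (dilationIsometry_apply_ae B hBdet g)] with x h1 h2
  rw [h1, h2, hBA, ← mul_assoc, ← Complex.ofReal_mul, ← Real.sqrt_mul (abs_nonneg _),
    ← abs_mul, mul_comm (LinearMap.det A), hdet, abs_one, Real.sqrt_one, Complex.ofReal_one,
    one_mul]

/-- The unitary dilation operator `D_A f (x) = |det A|^{1/2} f (A x)` on `L²(ℝ^d)`; its integer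
powers are taken in the group of unitary operators. -/
noncomputable def dilation (A : Rd d →ₗ[ℝ] Rd d) (hA : LinearMap.det A ≠ 0) :
    L2 d ≃ₗᵢ[ℂ] L2 d :=
  LinearIsometryEquiv.ofSurjective (dilationIsometry A hA) (dilationIsometry_surjective A hA)

theorem dilation_apply_ae (A : Rd d →ₗ[ℝ] Rd d) (hA : LinearMap.det A ≠ 0) (f : L2 d) :
    ∀ᵐ x, dilation A hA f x = ((Real.sqrt |LinearMap.det A| : ℝ) : ℂ) * f (A x) :=
  dilationIsometry_apply_ae A hA f

/-- The subspace `D_A^j W`, for `j ∈ ℤ`. -/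
noncomputable def dilate (A : Rd d →ₗ[ℝ] Rd d) (hA : LinearMap.det A ≠ 0) (j : ℤ)
    (W : Submodule ℂ (L2 d)) : Submodule ℂ (L2 d) :=
  W.map ((dilation A hA ^ j : L2 d ≃ₗᵢ[ℂ] L2 d).toLinearEquiv : L2 d →ₗ[ℂ] L2 d)

end Dilation

/-- `H = ⨁_j U_j`, an orthogonal direct sum of subspaces of a Hilbert space: the `U_j` are
mutually orthogonal and their span is dense in `H`. -/
def IsOrthogonalSum {d : ℕ} {J : Type} (H : Submodule ℂ (L2 d))
    (U : J → Submodule ℂ (L2 d)) : Prop :=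
  (∀ i j, i ≠ j → U i ⟂ U j) ∧ H = (⨆ j, U j).topologicalClosure

/-- The space `H²_G` of all `f ∈ L²(ℝ^d)` whose Fourier transform
`f̂(ξ) = ∫ f(x) e^{-2πi x·ξ} dx` vanishes almost everywhere outside `G`. -/
noncomputable def H2 {d : ℕ} (G : Set (Rd d)) : Submodule ℂ (L2 d) where
  carrier := {f | ∀ᵐ ξ, ξ ∉ G → (𝓕 f : L2 d) ξ = 0}
  zero_mem' := by
    have h : (𝓕 (0 : L2 d) : L2 d) = 0 := FourierTransform.fourier_zero
    rw [Set.mem_ofPred_eq, h]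
    filter_upwards [Lp.coeFn_zero ℂ 2 (volume : Measure (Rd d))] with ξ hξ _
    rw [hξ, Pi.zero_apply]
  add_mem' {f g} hf hg := by
    rw [Set.mem_ofPred_eq, FourierTransform.fourier_add]
    filter_upwards [hf, hg, Lp.coeFn_add (𝓕 f : L2 d) (𝓕 g)] with ξ h1 h2 h3 hξ
    rw [h3, Pi.add_apply, h1 hξ, h2 hξ, add_zero]
  smul_mem' c f hf := by
    rw [Set.mem_ofPred_eq, FourierTransform.fourier_smul]
    filter_upwards [hf, Lp.coeFn_smul c (𝓕 f : L2 d)] with ξ h1 h2 hξ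
    rw [h2, Pi.smul_apply, h1 hξ, smul_zero]

/-- `φ` is a tight frame generator of `V`: the `φ α` lie in `V` and
`∑_{α, k} |⟨f, φ α (· - k)⟩|² = ‖f‖²` for all `f ∈ V`. -/
structure IsTightFrameGenerator {d : ℕ} {ι : Type} (φ : ι → L2 d) (V : Submodule ℂ (L2 d)) :
    Prop where
  mem : ∀ α, φ α ∈ V
  hasSum : ∀ f ∈ V,
    HasSum (fun p : ι × (Fin d → ℤ) => ‖inner ℂ f (translate p.2 (φ p.1))‖ ^ 2) (‖f‖ ^ 2)

/-- `σ` is (a representative of) the spectral function of `V`: for some tight frame generator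
`φ` of `V`, the series `∑_α |φ̂_α(ξ)|²` converges to `σ(ξ)` for almost every `ξ`. -/
def IsSpectralFunction {d : ℕ} (V : Submodule ℂ (L2 d)) (σ : Rd d → ℝ) : Prop :=
  ∃ (ι : Type) (φ : ι → L2 d), IsTightFrameGenerator φ V ∧
    ∀ᵐ ξ, HasSum (fun α => ‖(𝓕 (φ α) : L2 d) ξ‖ ^ 2) (σ ξ)

/-- The origin is a point of `B`-density for `E`: for all `r > 0`,
`|E ∩ B^{-j} B_r| / |B^{-j} B_r| → 1` as `j → ∞`. -/
def IsDensityPoint {d : ℕ} (B : Rd d →ₗ[ℝ] Rd d) (E : Set (Rd d)) : Prop :=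
  ∀ r : ℝ, 0 < r →
    Tendsto (fun j : ℕ => volume (E ∩ (B ^ j) ⁻¹' Metric.ball 0 r) /
      volume ((B ^ j) ⁻¹' Metric.ball (0 : Rd d) r)) atTop (𝓝 1)

/-- The origin is a point of `B`-approximate continuity of `f`: `f(x) → f(0)` as `x → 0` inside
some Lebesgue measurable set `E` of positive measure for which the origin is a point of
`B`-density. -/
def IsApproxContinuousAtZero {d : ℕ} {Y : Type*} [TopologicalSpace Y] (B : Rd d →ₗ[ℝ] Rd d)
    (f : Rd d → Y) : Prop :=
  ∃ E : Set (Rd d), NullMeasurableSet E volume ∧ 0 < volume E ∧ IsDensityPoint B E ∧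
    Tendsto f (𝓝[E] 0) (𝓝 (f 0))

open Classical in
/-- The function `f` once we put `f(0) = c`. -/
noncomputable def withValueAtZero {d : ℕ} {Y : Type*} (f : Rd d → Y) (c : Y) : Rd d → Y :=
  Function.update f 0 c

end ShiftInvariant

-- The spectral function records how much of a frequency set is seen by the orthogonal projection
-- `P` onto `W`. If `K` lies in a unit cube and `f` has Fourier transform `1_K`, then `∫_K σ = ‖P
-- f‖²`. Indeed, for fixed `α` the numbers `⟨f, φ^α(· - k)⟩` are, up to conjugation, the Fourier
-- coefficients of `1_K · φ̂^α` on the cube, so Parseval and the tight frame identity for `P f` give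
-- the formula (`IsSpectralFunction.setLIntegral_enorm`).
--
-- Now let `f̂ = 1_{B_r}`. The Fourier transform of `D_A^{-j} f` is `|det A|^{j/2}` times the
-- indicator of `(A^*)^{-j} B_r`, and by expansiveness this set lies in a centred unit cube for
-- large `j`. Hence `|det A|^j ∫_{(A^*)^{-j} B_r} σ = ‖P D_A^{-j} f‖²`, which is the squared norm of
-- the projection of `f` onto `D_A^j W`. These spaces are mutually orthogonal, so Bessel's
-- inequality makes the squares summable and they tend to 0 (`tendsto_norm_starProjection_zero`).
--
-- Thus the averages of `σ ≥ 0` over `(A^*)^{-j} B_r` vanish in the limit. By Chebyshev every set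
-- `{σ ≥ c}` with `c > 0` has density zero at the origin, and a diagonal construction glues these
-- sets into one exceptional set (`isApproxContinuousAtZero_of_tendsto_average`).
--
-- A spectral function exists because projecting to `W` a family whose translates satisfy Parseval's
-- identity on `L²(ℝ^d)` gives a tight frame generator.

namespace ShiftInvariant

/-! ### Translations, dilations and the Fourier transform on `L²(ℝ^d)` -/

section Fourier

variable {d : ℕ}

/-- The character `ξ ↦ e^{-2πi k·ξ}`. -/
noncomputable def modulation (k : Fin d → ℤ) (ξ : Rd d) : ℂ :=
  (Real.fourierChar (-inner ℝ (latticePoint k) ξ) : ℂ)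

theorem norm_modulation (k : Fin d → ℤ) (ξ : Rd d) : ‖modulation k ξ‖ = 1 :=
  Circle.norm_coe _

theorem continuous_modulation (k : Fin d → ℤ) : Continuous (modulation (d := d) k) := by
  unfold modulation
  exact continuous_subtype_val.comp (Real.continuous_fourierChar.comp (by fun_prop))

theorem memLp_modulation_mul (k : Fin d → ℤ) (f : L2 d) :
    MemLp (fun ξ => modulation k ξ * f ξ) 2 volume := by
  refine (Lp.memLp f).of_le ?_ (ae_of_all _ fun ξ => ?_)
  · exact (continuous_modulation k).aestronglyMeasurable.mul (Lp.aestronglyMeasurable f)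
  · rw [norm_mul, norm_modulation, one_mul]

/-- Multiplication by `e^{-2πi k·ξ}` on `L²(ℝ^d)`. -/
noncomputable def modulate (k : Fin d → ℤ) : L2 d →ₗᵢ[ℂ] L2 d where
  toFun f := (memLp_modulation_mul k f).toLp _
  map_add' f g := by
    rw [← MemLp.toLp_add, MemLp.toLp_eq_toLp_iff]
    filter_upwards [Lp.coeFn_add f g] with x hx
    simp only [Pi.add_apply] at hx ⊢
    rw [hx, mul_add]
  map_smul' c f := by
    rw [RingHom.id_apply, ← MemLp.toLp_const_smul, MemLp.toLp_eq_toLp_iff]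
    filter_upwards [Lp.coeFn_smul c f] with x hx
    simp only [Pi.smul_apply, smul_eq_mul] at hx ⊢
    rw [hx]
    ring
  norm_map' f := by
    change ‖(memLp_modulation_mul k f).toLp _‖ = ‖f‖
    rw [Lp.norm_toLp, Lp.norm_def]
    congr 1
    exact eLpNorm_congr_norm_ae (ae_of_all _ fun ξ => by rw [norm_mul, norm_modulation, one_mul])

theorem modulate_apply_ae (k : Fin d → ℤ) (f : L2 d) :
    ∀ᵐ ξ, modulate k f ξ = modulation k ξ * f ξ :=
  MemLp.coeFn_toLp (memLp_modulation_mul k f)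

theorem translate_apply_ae (k : Fin d → ℤ) (f : L2 d) :
    ∀ᵐ x, translate k f x = f (x - latticePoint k) :=
  Lp.coeFn_compMeasurePreserving f (measurePreserving_sub_right volume (latticePoint k))

theorem fourier_translate (k : Fin d → ℤ) (f : L2 d) :
    (𝓕 (translate k f) : L2 d) = modulate k (𝓕 f) := by
  refine DenseRange.induction_on
    (p := fun f : L2 d => (𝓕 (translate k f) : L2 d) = modulate k (𝓕 f))
    (SchwartzMap.denseRange_toLpCLM (p := 2) ENNReal.ofNat_ne_top) f ?_ fun g => ?_
  · exact isClosed_eq ((Lp.fourierTransformₗᵢ (Rd d) ℂ).continuous.comp (translate k).continuous)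
      ((modulate k).continuous.comp (Lp.fourierTransformₗᵢ (Rd d) ℂ).continuous)
  · rw [SchwartzMap.toLpCLM_apply]
    have h : translate k (g.toLp 2) =
        (SchwartzMap.compSubConstCLM ℂ (latticePoint k) g).toLp 2 := by
      apply Lp.ext
      filter_upwards [translate_apply_ae k (g.toLp 2),
        (measurePreserving_sub_right volume (latticePoint k)).quasiMeasurePreserving.ae
          (g.coeFn_toLp 2 volume),
        (SchwartzMap.compSubConstCLM ℂ (latticePoint k) g).coeFn_toLp 2 volume] with x h1 h2 h3
      rw [h1, h2, h3, SchwartzMap.compSubConstCLM_apply]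
    rw [h, SchwartzMap.toLp_fourier_eq, SchwartzMap.toLp_fourier_eq]
    apply Lp.ext
    filter_upwards [modulate_apply_ae k ((𝓕 g).toLp 2), (𝓕 g).coeFn_toLp 2 volume,
      (𝓕 (SchwartzMap.compSubConstCLM ℂ (latticePoint k) g)).coeFn_toLp 2 volume] with ξ h1 h2 h3
    rw [h1, h2, h3, SchwartzMap.fourier_coe, SchwartzMap.fourier_coe]
    have h4 := congrFun (VectorFourier.fourierIntegral_comp_add_right Real.fourierChar
      (volume : Measure (Rd d)) (innerₗ (Rd d)) g (-latticePoint k)) ξ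
    have h5 : ((SchwartzMap.compSubConstCLM ℂ (latticePoint k) g : SchwartzMap (Rd d) ℂ) :
        Rd d → ℂ) = g ∘ fun x => x + -latticePoint k := by
      ext x
      simp [SchwartzMap.compSubConstCLM_apply, sub_eq_add_neg]
    rw [h5]
    refine h4.trans ?_
    simp [modulation, Circle.smul_def]
    rfl

theorem det_adjoint (A : Rd d →ₗ[ℝ] Rd d) :
    LinearMap.det (LinearMap.adjoint A) = LinearMap.det A := by
  have := LinearMap.det_toMatrix (EuclideanSpace.basisFun (Fin d) ℝ).toBasis (LinearMap.adjoint A)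
  rw [← this, LinearMap.toMatrix_adjoint,
    ← LinearMap.det_toMatrix (EuclideanSpace.basisFun (Fin d) ℝ).toBasis A, Matrix.det_conjTranspose]
  simp

/-- For Schwartz functions this is the substitution `w = A v` in the Fourier integral: its Jacobian
`|det A|⁻¹` cancels the two normalizing factors `|det A|^{1/2}`. Density and continuity do the rest.
Putting both dilations on one side avoids an inverse of `A^*`. -/
theorem dilation_adjoint_fourier_dilation (A : Rd d →ₗ[ℝ] Rd d) (hA : LinearMap.det A ≠ 0)
    (hA' : LinearMap.det (LinearMap.adjoint A) ≠ 0) (f : L2 d) :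
    dilation (LinearMap.adjoint A) hA' (𝓕 (dilation A hA f) : L2 d) = 𝓕 f := by
  refine DenseRange.induction_on
    (p := fun f : L2 d =>
      dilation (LinearMap.adjoint A) hA' (𝓕 (dilation A hA f) : L2 d) = 𝓕 f)
    (SchwartzMap.denseRange_toLpCLM (p := 2) ENNReal.ofNat_ne_top) f ?_ fun g => ?_
  · exact isClosed_eq ((dilation _ hA').continuous.comp
      ((Lp.fourierTransformₗᵢ (Rd d) ℂ).continuous.comp (dilation A hA).continuous))
      (Lp.fourierTransformₗᵢ (Rd d) ℂ).continuous
  · rw [SchwartzMap.toLpCLM_apply]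
    set e : Rd d ≃L[ℝ] Rd d := (A.equivOfDetNeZero hA).toContinuousLinearEquiv with he
    have heA : ∀ x, e x = A x := fun x => rfl
    set c : ℂ := ((Real.sqrt |LinearMap.det A| : ℝ) : ℂ) with hc
    set G : SchwartzMap (Rd d) ℂ := SchwartzMap.compCLMOfContinuousLinearEquiv ℂ e g with hG
    have hGx : ∀ x, G x = g (A x) := fun x => rfl
    have h : dilation A hA (g.toLp 2) = c • G.toLp 2 volume := by
      apply Lp.ext
      filter_upwards [dilation_apply_ae A hA (g.toLp 2),
        (quasiMeasurePreserving_linearMap hA).ae (g.coeFn_toLp 2 volume),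
        G.coeFn_toLp 2 volume, Lp.coeFn_smul c (G.toLp 2 volume)] with x h1 h2 h3 h4
      rw [h1, h2, h4, Pi.smul_apply, h3, hGx, smul_eq_mul]
    rw [h, FourierTransform.fourier_smul, SchwartzMap.toLp_fourier_eq,
      SchwartzMap.toLp_fourier_eq, map_smul]
    apply Lp.ext
    filter_upwards [Lp.coeFn_smul c (dilation (LinearMap.adjoint A) hA' ((𝓕 G).toLp 2)),
      dilation_apply_ae _ hA' ((𝓕 G).toLp 2), (𝓕 g).coeFn_toLp 2 volume,
      (quasiMeasurePreserving_linearMap hA').ae ((𝓕 G).coeFn_toLp 2 volume)] with ξ h1 h2 h3 h4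
    rw [h1, Pi.smul_apply, h2, h3, h4, SchwartzMap.fourier_coe, SchwartzMap.fourier_coe,
      Real.fourier_eq, Real.fourier_eq, det_adjoint, ← hc, smul_eq_mul, ← mul_assoc]
    have h5 : ∀ v : Rd d, Real.fourierChar (-inner ℝ v (LinearMap.adjoint A ξ)) • G v =
        (fun w : Rd d => Real.fourierChar (-inner ℝ w ξ) • g w) (A v) := by
      intro v
      rw [hGx, LinearMap.adjoint_inner_right]
    simp_rw [h5]
    have hpos : 0 < |LinearMap.det A| := abs_pos.mpr hA
    have h6 : ∫ v, (fun w : Rd d => Real.fourierChar (-inner ℝ w ξ) • g w) (A v) =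
        |(LinearMap.det A)⁻¹| • ∫ w : Rd d, Real.fourierChar (-inner ℝ w ξ) • g w := by
      have h7 := integral_map_equiv (μ := (volume : Measure (Rd d))) e.toHomeomorph.toMeasurableEquiv
        (fun w : Rd d => Real.fourierChar (-inner ℝ w ξ) • g w)
      have h8 : Measure.map e.toHomeomorph.toMeasurableEquiv (volume : Measure (Rd d)) =
          ENNReal.ofReal |(LinearMap.det A)⁻¹| • volume := map_volume_linearMap hA
      rw [h8, integral_smul_measure, ENNReal.toReal_ofReal (abs_nonneg _)] at h7
      exact h7.symm
    rw [h6, Complex.real_smul, ← mul_assoc]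
    have h9 : c * c * ((|(LinearMap.det A)⁻¹| : ℝ) : ℂ) = 1 := by
      rw [hc, ← Complex.ofReal_mul, Real.mul_self_sqrt hpos.le, ← Complex.ofReal_mul, abs_inv,
        mul_inv_cancel₀ hpos.ne', Complex.ofReal_one]
    rw [h9, one_mul]

theorem inner_fourier (f g : L2 d) : inner ℂ (𝓕 f : L2 d) (𝓕 g) = inner ℂ f g :=
  Lp.inner_fourier_eq f g

end Fourier

/-! ### Parseval's identity on unit cubes -/

section Parseval

variable {d : ℕ}

/-- The half-open unit cube `∏ᵢ (aᵢ, aᵢ + 1]`. -/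
def unitCube (a : Fin d → ℝ) : Set (Rd d) := {ξ | ∀ i, ξ i ∈ Set.Ioc (a i) (a i + 1)}

theorem measurableSet_unitCube (a : Fin d → ℝ) : MeasurableSet (unitCube a) := by
  have : unitCube a = (WithLp.ofLp : Rd d → Fin d → ℝ) ⁻¹'
      (Set.univ.pi fun i => Set.Ioc (a i) (a i + 1)) := by
    ext ξ; simp [unitCube]
  rw [this]
  exact (PiLp.volume_preserving_ofLp (Fin d)).measurable
    (MeasurableSet.univ_pi fun i => measurableSet_Ioc)

theorem volume_unitCube (a : Fin d → ℝ) : volume (unitCube a) = 1 := by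
  have : unitCube a = (WithLp.ofLp : Rd d → Fin d → ℝ) ⁻¹'
      (Set.univ.pi fun i => Set.Ioc (a i) (a i + 1)) := by
    ext ξ; simp [unitCube]
  rw [this, (PiLp.volume_preserving_ofLp (Fin d)).measure_preimage
    (MeasurableSet.univ_pi fun i => measurableSet_Ioc).nullMeasurableSet, volume_pi_pi]
  simp

/-- The Haar probability measure on the circle, as in Mathlib's theory of multiple Fourier
series. -/
noncomputable local instance circleMeasureSpace : MeasureSpace UnitAddCircle :=
  ⟨AddCircle.haarAddCircle⟩

/-- The section of `ℝ^d → (ℝ/ℤ)^d` with values in the cube `unitCube a`. -/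
noncomputable def torusSection (a : Fin d → ℝ) (t : UnitAddTorus (Fin d)) : Rd d :=
  WithLp.toLp 2 (UnitAddTorus.measurableEquivPiIoc a t).1

theorem measurePreserving_torusSection (a : Fin d → ℝ) :
    MeasurePreserving (torusSection a) volume (volume.restrict (unitCube a)) := by
  have h1 := UnitAddTorus.measurePreserving_equivPiIoc a
  have hS : MeasurableSet {x : Fin d → ℝ | ∀ i, x i ∈ Set.Ioc (a i) (a i + 1)} :=
    MeasurableSet.univ_pi' fun i => measurableSet_Ioc
  have h2 : MeasurePreserving
      (Subtype.val : {x : Fin d → ℝ // ∀ i, x i ∈ Set.Ioc (a i) (a i + 1)} → Fin d → ℝ)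
      (Measure.comap Subtype.val volume) (volume.restrict _) := measurePreserving_subtype_coe hS
  have h3 : MeasurePreserving (WithLp.toLp 2 : (Fin d → ℝ) → Rd d)
      (volume.restrict {x : Fin d → ℝ | ∀ i, x i ∈ Set.Ioc (a i) (a i + 1)})
      (volume.restrict (unitCube a)) :=
    (PiLp.volume_preserving_toLp (Fin d)).restrict_preimage (measurableSet_unitCube a)
  exact h3.comp (h2.comp h1)

theorem mFourier_neg_eq_modulation (a : Fin d → ℝ) (k : Fin d → ℤ) (t : UnitAddTorus (Fin d)) :
    UnitAddTorus.mFourier (-k) t = modulation k (torusSection a t) := by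
  have ht : ∀ i, t i = ((torusSection a t i : ℝ) : UnitAddCircle) := fun i =>
    ((AddCircle.equivIoc 1 (a i)).symm_apply_apply (t i)).symm
  set ξ := torusSection a t
  have : UnitAddTorus.mFourier (-k) t = ∏ i, fourier (-k i) (t i) := rfl
  rw [this]
  simp_rw [ht, fourier_coe_apply]
  rw [← Complex.exp_sum, modulation, Real.fourierChar_apply]
  congr 1
  simp only [latticePoint, PiLp.inner_apply, RCLike.inner_apply, conj_trivial]
  push_cast
  rw [← Finset.sum_neg_distrib, Finset.mul_sum, Finset.sum_mul]
  refine Finset.sum_congr rfl fun i _ => ?_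
  ring

/-- Parseval for multiple Fourier series, pulled back along the measure-preserving section of the
torus; the cube has volume 1, so no constant appears. -/
theorem hasSum_sq_integral_modulation (a : Fin d → ℝ) {h : Rd d → ℂ}
    (hh : MemLp h 2 (volume.restrict (unitCube a))) :
    HasSum (fun k => ‖∫ ξ in unitCube a, modulation k ξ * h ξ‖ ^ 2)
      (∫ ξ in unitCube a, ‖h ξ‖ ^ 2) := by
  have hmp := measurePreserving_torusSection a
  have hH : MemLp (h ∘ torusSection a) 2 volume := hh.comp_measurePreserving hmp
  have h1 := UnitAddTorus.hasSum_sq_mFourierCoeff (hH.toLp _)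
  have h2 : ∫ t, ‖hH.toLp _ t‖ ^ 2 = ∫ ξ in unitCube a, ‖h ξ‖ ^ 2 := by
    have h3 : ∫ t, ‖hH.toLp _ t‖ ^ 2 = ∫ t, ‖h (torusSection a t)‖ ^ 2 := by
      refine integral_congr_ae ?_
      filter_upwards [hH.coeFn_toLp] with t ht
      rw [ht, Function.comp_apply]
    rw [h3, ← hmp.map_eq, integral_map hmp.measurable.aemeasurable]
    rw [hmp.map_eq]
    exact hh.aestronglyMeasurable.norm.pow 2
  rw [h2] at h1
  refine h1.congr_fun fun k => ?_
  congr 2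
  have h4 : UnitAddTorus.mFourierCoeff (hH.toLp _) k =
      ∫ t, modulation k (torusSection a t) * h (torusSection a t) := by
    refine integral_congr_ae ?_
    filter_upwards [hH.coeFn_toLp] with t ht
    rw [ht, mFourier_neg_eq_modulation a, smul_eq_mul, Function.comp_apply]
  rw [h4]
  conv_lhs => rw [← hmp.map_eq]
  rw [integral_map hmp.measurable.aemeasurable]
  rw [hmp.map_eq]
  exact (continuous_modulation k).aestronglyMeasurable.mul hh.aestronglyMeasurable

theorem tsum_sq_integral_modulation (a : Fin d → ℝ) {h : Rd d → ℂ}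
    (hh : MemLp h 2 (volume.restrict (unitCube a))) :
    ∑' k, ‖∫ ξ in unitCube a, modulation k ξ * h ξ‖ₑ ^ 2 =
      ∫⁻ ξ in unitCube a, ‖h ξ‖ₑ ^ 2 := by
  have h1 := hasSum_sq_integral_modulation a hh
  have h2 : Integrable (fun ξ => ‖h ξ‖ ^ 2) (volume.restrict (unitCube a)) :=
    (memLp_two_iff_integrable_sq_norm hh.aestronglyMeasurable).1 hh
  have h3 := ofReal_integral_eq_lintegral_ofReal h2 (ae_of_all _ fun ξ => by positivity)
  rw [← h1.tsum_eq, ENNReal.ofReal_tsum_of_nonneg (fun _ => by positivity) h1.summable] at h3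
  simpa only [ENNReal.ofReal_pow (norm_nonneg _), ofReal_norm] using h3

end Parseval

/-! ### Spectral functions -/

section SpectralFunction

variable {d : ℕ}

theorem tsum_enorm_sq_eq_of_hasSum {ι E : Type*} [SeminormedAddCommGroup E] {u : ι → E} {s : ℝ}
    (h : HasSum (fun i => ‖u i‖ ^ 2) s) : ∑' i, ‖u i‖ₑ ^ 2 = ENNReal.ofReal s := by
  rw [← h.tsum_eq, ENNReal.ofReal_tsum_of_nonneg (fun _ => by positivity) h.summable]
  simp only [ENNReal.ofReal_pow (norm_nonneg _), ofReal_norm]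

theorem hasSum_of_tsum_enorm_sq_ne_top {ι E : Type*} [SeminormedAddCommGroup E] {u : ι → E}
    (h : ∑' i, ‖u i‖ₑ ^ 2 ≠ ∞) :
    HasSum (fun i => ‖u i‖ ^ 2) (∑' i, ‖u i‖ₑ ^ 2).toReal := by
  have h1 := ENNReal.hasSum_toReal h
  have h2 : ∀ i, (‖u i‖ₑ ^ 2).toReal = ‖u i‖ ^ 2 := fun i => by
    rw [ENNReal.toReal_pow, toReal_enorm]
  rw [ENNReal.tsum_toReal_eq (ENNReal.ne_top_of_tsum_ne_top h)]
  simpa only [h2] using h1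

theorem lintegral_enorm_sq (f : L2 d) : ∫⁻ ξ, ‖f ξ‖ₑ ^ 2 = ‖f‖ₑ ^ 2 := by
  have h := eLpNorm_nnreal_pow_eq_lintegral (μ := (volume : Measure (Rd d))) (f := f)
    (p := 2) (by norm_num)
  have h2 : eLpNorm f 2 volume = ‖f‖ₑ := (Lp.enorm_def f).symm
  simp only [NNReal.coe_ofNat, ENNReal.rpow_ofNat, ENNReal.coe_ofNat] at h
  rw [← h, h2]

theorem translate_translate_neg (k : Fin d → ℤ) (f : L2 d) :
    translate k (translate (-k) f) = f := by
  apply Lp.ext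
  filter_upwards [translate_apply_ae k (translate (-k) f),
    (measurePreserving_sub_right volume (latticePoint k)).quasiMeasurePreserving.ae
      (translate_apply_ae (-k) f)] with x h1 h2
  rw [h1, h2]
  congr 1
  ext i
  simp [latticePoint]

theorem translate_zero (f : L2 d) : translate 0 f = f := by
  apply Lp.ext
  filter_upwards [translate_apply_ae 0 f] with x h1
  rw [h1]
  congr 1
  ext i
  simp [latticePoint]

theorem inner_translate_right (k : Fin d → ℤ) (f g : L2 d) :
    inner ℂ f (translate k g) = inner ℂ (translate (-k) f) g := by
  conv_lhs => rw [← translate_translate_neg k f]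
  exact (translate k).inner_map_map _ _

theorem volume_ne_top_of_subset_unitCube {a : Fin d → ℝ} {K : Set (Rd d)}
    (hK : K ⊆ unitCube a) : volume K ≠ ∞ :=
  ((measure_mono hK).trans_lt (by rw [volume_unitCube]; exact ENNReal.one_lt_top)).ne

/-- The function whose Fourier transform is the indicator function of `K`. -/
noncomputable def bandFunction {K : Set (Rd d)} (hK : MeasurableSet K) (hK' : volume K ≠ ∞) :
    L2 d :=
  𝓕⁻ (indicatorConstLp 2 hK hK' (1 : ℂ))

theorem fourier_bandFunction {K : Set (Rd d)} (hK : MeasurableSet K) (hK' : volume K ≠ ∞) :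
    (𝓕 (bandFunction hK hK') : L2 d) = indicatorConstLp 2 hK hK' (1 : ℂ) :=
  FourierTransform.fourier_fourierInv_eq _

/-- By Plancherel the inner products are the Fourier coefficients of `1_K ĝ` on the cube. Since `K`
lies in a single cube, no two of its points are congruent modulo `ℤ^d`, and Parseval applies without
periodization. -/
theorem tsum_sq_inner_bandFunction {a : Fin d → ℝ} {K : Set (Rd d)} (hK : MeasurableSet K)
    (hK' : volume K ≠ ∞) (hKa : K ⊆ unitCube a) (g : L2 d) :
    ∑' k, ‖(inner ℂ (bandFunction hK hK') (translate k g) : ℂ)‖ₑ ^ 2 =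
      ∫⁻ ξ in K, ‖(𝓕 g : L2 d) ξ‖ₑ ^ 2 := by
  have h1 : ∀ k, (inner ℂ (bandFunction hK hK') (translate k g) : ℂ) =
      ∫ ξ in unitCube a, modulation k ξ * K.indicator (𝓕 g : L2 d) ξ := by
    intro k
    rw [← inner_fourier, fourier_bandFunction, fourier_translate,
      L2.inner_indicatorConstLp_one]
    have h2 : ∀ ξ, modulation k ξ * K.indicator (𝓕 g : L2 d) ξ =
        K.indicator (fun ξ => modulation k ξ * (𝓕 g : L2 d) ξ) ξ := fun ξ => by
      by_cases hξ : ξ ∈ K <;> simp [hξ]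
    simp_rw [h2]
    rw [setIntegral_indicator hK, Set.inter_eq_self_of_subset_right hKa]
    exact setIntegral_congr_ae hK ((modulate_apply_ae k _).mono fun ξ h _ => h)
  simp_rw [h1]
  rw [tsum_sq_integral_modulation a (((Lp.memLp (𝓕 g : L2 d)).indicator hK).restrict _)]
  have h3 : ∀ ξ, ‖K.indicator (𝓕 g : L2 d) ξ‖ₑ ^ 2 =
      K.indicator (fun ξ => ‖(𝓕 g : L2 d) ξ‖ₑ ^ 2) ξ := fun ξ => by
    by_cases hξ : ξ ∈ K <;> simp [hξ]
  simp_rw [h3]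
  rw [setLIntegral_indicator hK, Set.inter_eq_self_of_subset_left hKa]

theorem aemeasurable_enorm_sq (g : L2 d) :
    AEMeasurable (fun ξ => ‖g ξ‖ₑ ^ 2) volume :=
  (Lp.aestronglyMeasurable g).enorm.pow_const 2

/-- The frame identity holds only on `V`, but the translates of the `φ α` lie in `V`, so the band
function can be replaced by its projection in every inner product. The right-hand side does not
involve the generator. -/
theorem setLIntegral_tsum_fourier {ι : Type} [Countable ι] {φ : ι → L2 d}
    {V : Submodule ℂ (L2 d)} [V.HasOrthogonalProjection] (hV : IsShiftInvariant V)
    (hφ : IsTightFrameGenerator φ V) {a : Fin d → ℝ} {K : Set (Rd d)} (hK : MeasurableSet K)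
    (hK' : volume K ≠ ∞) (hKa : K ⊆ unitCube a) :
    ∫⁻ ξ in K, ∑' α, ‖(𝓕 (φ α) : L2 d) ξ‖ₑ ^ 2 =
      ‖V.starProjection (bandFunction hK hK')‖ₑ ^ 2 := by
  rw [lintegral_tsum fun α => (aemeasurable_enorm_sq _).restrict]
  simp_rw [← tsum_sq_inner_bandFunction hK hK' hKa]
  have h1 : ∀ α k, (inner ℂ (bandFunction hK hK') (translate k (φ α)) : ℂ) =
      inner ℂ (V.starProjection (bandFunction hK hK')) (translate k (φ α)) := fun α k => by
    rw [Submodule.inner_starProjection_left_eq_right,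
      Submodule.starProjection_eq_self_iff.2 (hV.translate_mem _ (hφ.mem α) k)]
  simp_rw [h1]
  rw [← ENNReal.tsum_prod (f := fun α k =>
      ‖(inner ℂ (V.starProjection (bandFunction hK hK')) (translate k (φ α)) : ℂ)‖ₑ ^ 2),
    tsum_enorm_sq_eq_of_hasSum (hφ.hasSum _ (Submodule.starProjection_apply_mem _ _)),
    ENNReal.ofReal_pow (norm_nonneg _), ofReal_norm]

/-- A convergent sum has countable support, so each member of a dense sequence pairs nontrivially
with only countably many `φ α`, whereas a nonzero `φ α` cannot be orthogonal to the whole sequence.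
Countability is what permits exchanging the sum over `α` with the integral. -/
theorem IsTightFrameGenerator.countable_ne_zero {ι : Type} {φ : ι → L2 d}
    {V : Submodule ℂ (L2 d)} [V.HasOrthogonalProjection] (hφ : IsTightFrameGenerator φ V) :
    {α | φ α ≠ 0}.Countable := by
  have : Fact ((2 : ℝ≥0∞) ≠ ∞) := ⟨ENNReal.ofNat_ne_top⟩
  set u := TopologicalSpace.denseSeq (L2 d)
  refine Set.Countable.mono ?_ (Set.countable_iUnion fun n =>
    ((hφ.hasSum _ (V.starProjection_apply_mem (u n))).summable.countable_support.image Prod.fst))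
  intro α hα
  by_contra hcon
  refine hα ?_
  have h0 : ∀ n, (inner ℂ (u n) (φ α) : ℂ) = 0 := by
    intro n
    by_contra hn
    -- The untranslated term `k = 0` already witnesses that `α` is in the support.
    refine hcon (Set.mem_iUnion.2 ⟨n, (α, 0), ?_, rfl⟩)
    rw [Function.mem_support]
    refine pow_ne_zero 2 (norm_ne_zero_iff.2 ?_)
    rwa [translate_zero, Submodule.inner_starProjection_left_eq_right,
      Submodule.starProjection_eq_self_iff.2 (hφ.mem α)]
  have h1 : ∀ g : L2 d, (inner ℂ g (φ α) : ℂ) = 0 := fun g =>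
    (TopologicalSpace.denseRange_denseSeq (L2 d)).induction_on
      (p := fun g : L2 d => (inner ℂ g (φ α) : ℂ) = 0) g
      (isClosed_eq (by fun_prop) continuous_const) h0
  exact inner_self_eq_zero.1 (h1 (φ α))

theorem IsSpectralFunction.exists_countable {V : Submodule ℂ (L2 d)} [V.HasOrthogonalProjection]
    {σ : Rd d → ℝ} (hσ : IsSpectralFunction V σ) :
    ∃ (ι : Type) (φ : ι → L2 d), Countable ι ∧ IsTightFrameGenerator φ V ∧
      ∀ᵐ ξ, HasSum (fun α => ‖(𝓕 (φ α) : L2 d) ξ‖ ^ 2) (σ ξ) := by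
  obtain ⟨ι, φ, hφ, hsum⟩ := hσ
  refine ⟨{α | φ α ≠ 0}, fun α => φ α, hφ.countable_ne_zero.to_subtype,
    ⟨fun α => hφ.mem α, fun f hf => ?_⟩, ?_⟩
  · have hinj : Function.Injective
        (Prod.map Subtype.val id : {α | φ α ≠ 0} × (Fin d → ℤ) → ι × (Fin d → ℤ)) :=
      Subtype.val_injective.prodMap Function.injective_id
    refine (hinj.hasSum_iff fun p hp => ?_).2 (hφ.hasSum f hf)
    have : φ p.1 = 0 := by
      by_contra h
      exact hp ⟨(⟨p.1, h⟩, p.2), rfl⟩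
    rw [this, map_zero, inner_zero_right, norm_zero, zero_pow two_ne_zero]
  · filter_upwards [hsum, Lp.coeFn_zero ℂ 2 (volume : Measure (Rd d))] with ξ hξ h0
    refine (hasSum_subtype_iff_of_support_subset ?_).2 hξ
    intro α hα h
    refine hα ?_
    change ‖(𝓕 (φ α) : L2 d) ξ‖ ^ 2 = 0
    have h2 : (𝓕 (0 : L2 d) : L2 d) = 0 := FourierTransform.fourier_zero
    rw [h, h2, h0, Pi.zero_apply, norm_zero, zero_pow two_ne_zero]

theorem IsSpectralFunction.aemeasurable {V : Submodule ℂ (L2 d)} [V.HasOrthogonalProjection]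
    {σ : Rd d → ℝ} (hσ : IsSpectralFunction V σ) : AEMeasurable σ volume := by
  obtain ⟨ι, φ, _, -, hsum⟩ := hσ.exists_countable
  have h1 : AEMeasurable (fun ξ => (∑' α, ‖(𝓕 (φ α) : L2 d) ξ‖ₑ ^ 2).toReal) volume :=
    (AEMeasurable.tsum fun α => aemeasurable_enorm_sq _).ennreal_toReal
  refine h1.congr ?_
  filter_upwards [hsum] with ξ hξ
  rw [tsum_enorm_sq_eq_of_hasSum hξ, ENNReal.toReal_ofReal]
  exact hξ.nonneg fun _ => by positivity

theorem IsSpectralFunction.setLIntegral_enorm {V : Submodule ℂ (L2 d)}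
    [V.HasOrthogonalProjection] {σ : Rd d → ℝ} (hσ : IsSpectralFunction V σ)
    (hV : IsShiftInvariant V) {a : Fin d → ℝ} {K : Set (Rd d)} (hK : MeasurableSet K)
    (hK' : volume K ≠ ∞) (hKa : K ⊆ unitCube a) :
    ∫⁻ ξ in K, ‖σ ξ‖ₑ = ‖V.starProjection (bandFunction hK hK')‖ₑ ^ 2 := by
  obtain ⟨ι, φ, _, hφ, hsum⟩ := hσ.exists_countable
  rw [← setLIntegral_tsum_fourier hV hφ hK hK' hKa]
  refine setLIntegral_congr_fun_ae hK ?_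
  filter_upwards [hsum] with ξ hξ _
  rw [tsum_enorm_sq_eq_of_hasSum hξ, Real.enorm_of_nonneg (hξ.nonneg fun _ => by positivity)]

theorem iUnion_unitCube :
    ⋃ α : Fin d → ℤ, unitCube (fun i => (α i : ℝ)) = Set.univ := by
  -- The cubes are open on the left and closed on the right, hence the ceiling minus one instead of
  -- the floor.
  refine Set.eq_univ_of_forall fun ξ => Set.mem_iUnion.2 ⟨fun i => ⌈ξ i⌉ - 1, fun i => ?_⟩
  have h1 := Int.ceil_lt_add_one (ξ i)
  have h2 := Int.le_ceil (ξ i)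
  simp only [Int.cast_sub, Int.cast_one, Set.mem_Ioc]
  constructor <;> linarith

theorem pairwise_disjoint_unitCube :
    Pairwise (Function.onFun Disjoint fun α : Fin d → ℤ => unitCube (fun i => (α i : ℝ))) := by
  intro α β hαβ
  refine Set.disjoint_left.2 fun ξ h1 h2 => hαβ (funext fun i => ?_)
  have h3 := h1 i
  have h4 := h2 i
  simp only [Set.mem_Ioc] at h3 h4
  have h5 : (α i : ℝ) < β i + 1 := by linarith
  have h6 : (β i : ℝ) < α i + 1 := by linarith
  have h7 : α i < β i + 1 := by exact_mod_cast h5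
  have h8 : β i < α i + 1 := by exact_mod_cast h6
  omega

/-- The functions whose Fourier transforms are the indicators of the cubes `α + (0, 1]^d`. Their
lattice translates form an orthonormal basis of `L²(ℝ^d)`. -/
noncomputable def cubeFunction (α : Fin d → ℤ) : L2 d :=
  bandFunction (measurableSet_unitCube fun i => (α i : ℝ))
    (volume_ne_top_of_subset_unitCube subset_rfl)

/-- Parseval on each cube gives the integral of `|f̂|²` over that cube; the cubes tile `ℝ^d`, and
Plancherel concludes. -/
theorem hasSum_sq_inner_cubeFunction (f : L2 d) :
    HasSum (fun p : (Fin d → ℤ) × (Fin d → ℤ) =>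
      ‖(inner ℂ f (translate p.2 (cubeFunction p.1)) : ℂ)‖ ^ 2) (‖f‖ ^ 2) := by
  have h1 : ∑' p : (Fin d → ℤ) × (Fin d → ℤ),
      ‖(inner ℂ f (translate p.2 (cubeFunction p.1)) : ℂ)‖ₑ ^ 2 = ‖f‖ₑ ^ 2 := by
    rw [ENNReal.tsum_prod (f := fun α k =>
      ‖(inner ℂ f (translate k (cubeFunction α)) : ℂ)‖ₑ ^ 2)]
    have h2 : ∀ α : Fin d → ℤ,
        ∑' k, ‖(inner ℂ f (translate k (cubeFunction α)) : ℂ)‖ₑ ^ 2 =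
          ∫⁻ ξ in unitCube (fun i => (α i : ℝ)), ‖(𝓕 f : L2 d) ξ‖ₑ ^ 2 := by
      intro α
      -- Here the translation sits on the band function and not on `f`; moving it across replaces
      -- `k` by `-k`, which only permutes the sum.
      rw [← tsum_sq_inner_bandFunction (measurableSet_unitCube fun i => (α i : ℝ))
        (volume_ne_top_of_subset_unitCube subset_rfl) subset_rfl, ← (Equiv.neg _).tsum_eq]
      refine tsum_congr fun k => ?_
      rw [Equiv.neg_apply, inner_translate_right, neg_neg, ← inner_conj_symm, RCLike.enorm_conj]
      rfl
    simp_rw [h2]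
    rw [← lintegral_iUnion (fun α => measurableSet_unitCube _) pairwise_disjoint_unitCube,
      iUnion_unitCube, setLIntegral_univ, lintegral_enorm_sq]
    congr 1
    rw [← ofReal_norm, ← ofReal_norm, Lp.norm_fourier_eq]
  have h3 := hasSum_of_tsum_enorm_sq_ne_top (h1.trans_ne (by finiteness))
  rwa [h1, ENNReal.toReal_pow, toReal_enorm] at h3

/-- For `f ∈ V` the projection is invisible: the translation moves onto `f`, which stays in `V`, and
the self-adjoint projection then fixes it. -/
theorem isTightFrameGenerator_starProjection_cubeFunction {V : Submodule ℂ (L2 d)}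
    [V.HasOrthogonalProjection] (hV : IsShiftInvariant V) :
    IsTightFrameGenerator (fun α => V.starProjection (cubeFunction α)) V := by
  refine ⟨fun α => V.starProjection_apply_mem _, fun f hf => ?_⟩
  refine (hasSum_sq_inner_cubeFunction f).congr_fun fun p => ?_
  rw [inner_translate_right, inner_translate_right,
    ← Submodule.inner_starProjection_left_eq_right,
    Submodule.starProjection_eq_self_iff.2 (hV.translate_mem f hf _)]

/-- The only issue is almost everywhere finiteness of the series; its integral over each unit cube
is the squared norm of a projection, hence finite. -/
theorem exists_isSpectralFunction {V : Submodule ℂ (L2 d)} [V.HasOrthogonalProjection]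
    (hV : IsShiftInvariant V) : ∃ σ : Rd d → ℝ, IsSpectralFunction V σ := by
  have hφ := isTightFrameGenerator_starProjection_cubeFunction hV
  set φ : (Fin d → ℤ) → L2 d := fun α => V.starProjection (cubeFunction α)
  refine ⟨fun ξ => (∑' α, ‖(𝓕 (φ α) : L2 d) ξ‖ₑ ^ 2).toReal, _, φ, hφ, ?_⟩
  have h1 : ∀ β : Fin d → ℤ, ∀ᵐ ξ ∂(volume.restrict (unitCube fun i => (β i : ℝ))),
      ∑' α, ‖(𝓕 (φ α) : L2 d) ξ‖ₑ ^ 2 < ∞ := by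
    intro β
    refine ae_lt_top' (AEMeasurable.tsum fun α => (aemeasurable_enorm_sq _).restrict) ?_
    rw [setLIntegral_tsum_fourier hV hφ (measurableSet_unitCube _)
      (volume_ne_top_of_subset_unitCube subset_rfl) subset_rfl]
    finiteness
  have h2 := (ae_restrict_iUnion_iff _ _).2 h1
  rw [iUnion_unitCube, Measure.restrict_univ] at h2
  filter_upwards [h2] with ξ hξ
  exact hasSum_of_tsum_enorm_sq_ne_top hξ.ne

end SpectralFunction

/-! ### Approximate continuity from the decay of averages -/

section ApproxContinuity

variable {d : ℕ}

theorem volume_preimage_pow {B : Rd d →ₗ[ℝ] Rd d} (hB : LinearMap.det B ≠ 0) (j : ℕ)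
    (S : Set (Rd d)) :
    volume ((B ^ j) ⁻¹' S) = ENNReal.ofReal |(LinearMap.det B ^ j)⁻¹| * volume S := by
  rw [Measure.addHaar_preimage_linearMap _ (by rw [map_pow]; exact pow_ne_zero j hB), map_pow]

theorem measurableSet_preimage_pow (B : Rd d →ₗ[ℝ] Rd d) (j : ℕ) {S : Set (Rd d)}
    (hS : MeasurableSet S) : MeasurableSet ((B ^ j) ⁻¹' S) :=
  (B ^ j).continuous_of_finiteDimensional.measurable hS

theorem tendsto_volume_ball_zero (hd : 1 ≤ d) :
    Tendsto (fun δ : ℝ => volume (Metric.ball (0 : Rd d) δ)) (𝓝[>] 0) (𝓝 0) := by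
  have h1 : Tendsto (fun δ : ℝ => ENNReal.ofReal (δ ^ d) * volume (Metric.ball (0 : Rd d) 1))
      (𝓝[>] 0) (𝓝 0) := by
    have h2 : Tendsto (fun δ : ℝ => ENNReal.ofReal (δ ^ d)) (𝓝[>] 0) (𝓝 0) := by
      have h3 : Tendsto (fun δ : ℝ => ENNReal.ofReal (δ ^ d)) (𝓝 0)
          (𝓝 (ENNReal.ofReal (0 ^ d))) :=
        (ENNReal.continuous_ofReal.comp (continuous_pow d)).tendsto 0
      rw [zero_pow (by omega), ENNReal.ofReal_zero] at h3
      exact h3.mono_left nhdsWithin_le_nhds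
    have h4 := ENNReal.Tendsto.mul_const (b := volume (Metric.ball (0 : Rd d) 1)) h2
      (Or.inr measure_ball_lt_top.ne)
    rwa [zero_mul] at h4
  refine h1.congr' ?_
  filter_upwards [self_mem_nhdsWithin] with δ hδ
  rw [Measure.addHaar_ball_of_pos volume 0 hδ, finrank_euclideanSpace_fin]

/-- A set which has density zero along every family `B^{-j} B_r` still has density zero after
taking the union of countably many such sets, provided each is cut down to a small ball. -/
theorem exists_pos_tendsto_iUnion (hd : 1 ≤ d) {B : Rd d →ₗ[ℝ] Rd d} {D : ℕ → ℝ≥0∞}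
    (hD0 : ∀ j, D j ≠ 0) (hD : ∀ (j : ℕ) (S : Set (Rd d)), volume ((B ^ j) ⁻¹' S) = D j * volume S)
    (S : ℕ → Set (Rd d))
    (hS : ∀ n, ∀ r : ℝ, 0 < r →
      Tendsto (fun j : ℕ => volume (S n ∩ (B ^ j) ⁻¹' Metric.ball 0 r) / D j) atTop (𝓝 0)) :
    ∃ δ : ℕ → ℝ, (∀ n, 0 < δ n) ∧ ∀ r : ℝ, 0 < r →
      Tendsto (fun j : ℕ => volume ((⋃ n, S n ∩ Metric.ball 0 (δ n)) ∩
        (B ^ j) ⁻¹' Metric.ball 0 r) / D j) atTop (𝓝 0) := by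
  -- The bound must be uniform in `j`: density zero handles all large `j`, and a small `δ` handles
  -- the finitely many others, since the small ball then has tiny volume. The test radius `n + 1`
  -- grows so that any fixed `r` is eventually covered.
  have hex : ∀ n : ℕ, ∃ δ : ℝ, 0 < δ ∧ ∀ j : ℕ, volume (S n ∩ Metric.ball 0 δ ∩
      (B ^ j) ⁻¹' Metric.ball 0 ((n : ℝ) + 1)) / D j ≤ 2⁻¹ ^ n := by
    intro n
    have hpos : (0 : ℝ≥0∞) < 2⁻¹ ^ n :=
      pos_iff_ne_zero.2 (pow_ne_zero _ (ENNReal.inv_ne_zero.2 ENNReal.ofNat_ne_top))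
    obtain ⟨J, hJ⟩ := eventually_atTop.1
      ((tendsto_order.1 (hS n ((n : ℝ) + 1) (by positivity))).2 _ hpos)
    have h1 : ∀ j ∈ Finset.range J, ∀ᶠ δ : ℝ in 𝓝[>] 0,
        volume (Metric.ball (0 : Rd d) δ) / D j < 2⁻¹ ^ n := by
      intro j _
      have h2 := ENNReal.Tendsto.div_const (b := D j) (tendsto_volume_ball_zero hd)
        (Or.inr (hD0 j))
      rw [ENNReal.zero_div] at h2
      exact (tendsto_order.1 h2).2 _ hpos
    obtain ⟨δ, hδ, hδ0⟩ := (((Finset.eventually_all _).2 h1).and self_mem_nhdsWithin).exists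
    refine ⟨δ, hδ0, fun j => ?_⟩
    by_cases hj : j < J
    · refine le_trans ?_ (hδ j (Finset.mem_range.2 hj)).le
      gcongr
      exact Set.inter_subset_left.trans Set.inter_subset_right
    · refine le_trans ?_ (hJ j (not_lt.1 hj)).le
      gcongr
      exact Set.inter_subset_left
  choose δ hδ0 hδ using hex
  refine ⟨δ, hδ0, fun r hr => ?_⟩
  set t : ℕ → ℕ → ℝ≥0∞ := fun j n =>
    volume (S n ∩ Metric.ball 0 (δ n) ∩ (B ^ j) ⁻¹' Metric.ball 0 r) / D j with ht
  set b : ℝ≥0∞ := volume (Metric.ball (0 : Rd d) r) with hb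
  have hbtop : b ≠ ∞ := measure_ball_lt_top.ne
  obtain ⟨N, hN⟩ := exists_nat_ge r
  -- A summable majorant independent of `j`. For `n ≥ N` the choice of `δ n` applies because `r ≤ n
  -- + 1`; for `n < N` there is only the trivial bound `b`, absorbed by the factor `2 ^ N`.
  have hbound : ∀ j n, t j n ≤ 2⁻¹ ^ n * (1 + b * 2 ^ N) := by
    intro j n
    by_cases hn : n < N
    · calc t j n ≤ volume ((B ^ j) ⁻¹' Metric.ball 0 r) / D j := by
            simp only [ht]
            gcongr
            exact Set.inter_subset_right
        _ ≤ b := by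
            rw [hD]
            exact ENNReal.div_le_of_le_mul' le_rfl
        _ = 2⁻¹ ^ N * (b * 2 ^ N) := by
            rw [mul_comm b, ← mul_assoc, ← mul_pow, ENNReal.inv_mul_cancel two_ne_zero
              ENNReal.ofNat_ne_top, one_pow, one_mul]
        _ ≤ 2⁻¹ ^ n * (1 + b * 2 ^ N) := by
            refine mul_le_mul' (pow_le_pow_right_of_le_one' ?_ hn.le) le_add_self
            exact ENNReal.inv_le_one.2 one_le_two
    · refine le_trans ?_ ((hδ n j).trans (le_mul_of_one_le_right' le_self_add))
      simp only [ht]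
      have h2 : r ≤ (n : ℝ) + 1 := by
        have : (N : ℝ) ≤ n := by exact_mod_cast not_lt.1 hn
        linarith
      gcongr
  have hlim : ∀ n, Tendsto (fun j : ℕ => t j n) atTop (𝓝 0) := fun n =>
    tendsto_of_tendsto_of_tendsto_of_le_of_le tendsto_const_nhds (hS n r hr) (fun _ => zero_le)
      fun j => by
        simp only [ht]
        gcongr
        exact Set.inter_subset_left
  -- Dominated convergence for the counting measure on `ℕ`.
  have hsum : Tendsto (fun j : ℕ => ∑' n, t j n) atTop (𝓝 0) := by
    have h1 := tendsto_lintegral_of_dominated_convergence (μ := Measure.count)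
      (F := t) (f := fun _ => 0) (fun n : ℕ => 2⁻¹ ^ n * (1 + b * 2 ^ N))
      (fun j => measurable_of_countable _) (fun j => ae_of_all _ (hbound j)) ?_
      (ae_of_all _ hlim)
    · simpa only [lintegral_count, lintegral_zero] using h1
    · rw [lintegral_count, ENNReal.tsum_mul_right, ENNReal.tsum_geometric]
      have : (1 : ℝ≥0∞) - 2⁻¹ ≠ 0 := by simp
      exact ENNReal.mul_ne_top (ENNReal.inv_ne_top.2 this)
        (ENNReal.add_ne_top.2 ⟨ENNReal.one_ne_top, ENNReal.mul_ne_top hbtop (by finiteness)⟩)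
  refine tendsto_of_tendsto_of_tendsto_of_le_of_le tendsto_const_nhds hsum (fun _ => zero_le)
    fun j => ?_
  simp only [ht, div_eq_mul_inv]
  rw [ENNReal.tsum_mul_right, Set.iUnion_inter]
  gcongr
  exact measure_iUnion_le _

/-- By Chebyshev each `{|σ| ≥ 1/(n+1)}` has density zero at the origin. Cutting the `n`-th set down
to a small ball keeps the union `F` of density zero, while off `F` the bound `|σ| < 1/(n+1)` still
holds near the origin. The averages are normalized by the Jacobian, which differs from the volume of
`B^{-j} B_r` by a factor independent of `j`. -/
theorem isApproxContinuousAtZero_of_tendsto_average (hd : 1 ≤ d) {B : Rd d →ₗ[ℝ] Rd d}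
    (hB : LinearMap.det B ≠ 0) {σ : Rd d → ℝ} (hσ : AEMeasurable σ volume)
    (h : ∀ r : ℝ, 0 < r →
      Tendsto (fun j : ℕ => (∫⁻ ξ in (B ^ j) ⁻¹' Metric.ball 0 r, ‖σ ξ‖ₑ) /
        ENNReal.ofReal |(LinearMap.det B ^ j)⁻¹|) atTop (𝓝 0)) :
    IsApproxContinuousAtZero B (withValueAtZero σ 0) := by
  set D : ℕ → ℝ≥0∞ := fun j => ENNReal.ofReal |(LinearMap.det B ^ j)⁻¹| with hDdef
  have hD0 : ∀ j, D j ≠ 0 := fun j => by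
    simp only [hDdef, ne_eq, ENNReal.ofReal_eq_zero, not_le]
    exact abs_pos.2 (inv_ne_zero (pow_ne_zero _ hB))
  have hDtop : ∀ j, D j ≠ ∞ := fun j => ENNReal.ofReal_ne_top
  have hD : ∀ (j : ℕ) (S : Set (Rd d)), volume ((B ^ j) ⁻¹' S) = D j * volume S :=
    volume_preimage_pow hB
  set c : ℕ → ℝ≥0∞ := fun n => ((n : ℝ≥0∞) + 1)⁻¹ with hc
  have hc0 : ∀ n, c n ≠ 0 := fun n => ENNReal.inv_ne_zero.2 (by finiteness)
  have hctop : ∀ n, c n ≠ ∞ := fun n => ENNReal.inv_ne_top.2 (by simp)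
  set S : ℕ → Set (Rd d) := fun n => {ξ | c n ≤ ‖σ ξ‖ₑ} with hSdef
  have hSmeas : ∀ n, NullMeasurableSet (S n) volume := fun n =>
    hσ.enorm.nullMeasurable measurableSet_Ici
  have hS : ∀ n, ∀ r : ℝ, 0 < r →
      Tendsto (fun j : ℕ => volume (S n ∩ (B ^ j) ⁻¹' Metric.ball 0 r) / D j) atTop (𝓝 0) := by
    intro n r hr
    have h1 := ENNReal.Tendsto.div_const (b := c n) (h r hr) (Or.inr (hc0 n))
    rw [ENNReal.zero_div] at h1
    refine tendsto_of_tendsto_of_tendsto_of_le_of_le tendsto_const_nhds h1 (fun _ => zero_le)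
      fun j => ?_
    have h2 := meas_ge_le_lintegral_div
      (μ := volume.restrict ((B ^ j) ⁻¹' Metric.ball (0 : Rd d) r)) (f := fun ξ => ‖σ ξ‖ₑ)
      hσ.enorm.restrict (hc0 n) (hctop n)
    rw [Measure.restrict_apply' (measurableSet_preimage_pow B j measurableSet_ball)] at h2
    calc volume (S n ∩ (B ^ j) ⁻¹' Metric.ball 0 r) / D j
        ≤ (∫⁻ ξ in (B ^ j) ⁻¹' Metric.ball 0 r, ‖σ ξ‖ₑ) / c n / D j := by gcongr
      _ = _ := by simp only [div_eq_mul_inv]; rw [mul_right_comm]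
  obtain ⟨δ, hδ0, hδ⟩ := exists_pos_tendsto_iUnion hd hD0 hD S hS
  set F : Set (Rd d) := ⋃ n, S n ∩ Metric.ball 0 (δ n) with hF
  have hFmeas : NullMeasurableSet F volume :=
    NullMeasurableSet.iUnion fun n => (hSmeas n).inter measurableSet_ball.nullMeasurableSet
  have hdens : IsDensityPoint B Fᶜ := by
    intro r hr
    have hb0 : volume (Metric.ball (0 : Rd d) r) ≠ 0 := (Metric.measure_ball_pos _ _ hr).ne'
    have hbtop : volume (Metric.ball (0 : Rd d) r) ≠ ∞ := measure_ball_lt_top.ne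
    have h1 : Tendsto (fun j : ℕ => volume (F ∩ (B ^ j) ⁻¹' Metric.ball 0 r) /
        volume ((B ^ j) ⁻¹' Metric.ball (0 : Rd d) r)) atTop (𝓝 0) := by
      have h2 := ENNReal.Tendsto.div_const (b := volume (Metric.ball (0 : Rd d) r)) (hδ r hr)
        (Or.inr hb0)
      rw [ENNReal.zero_div] at h2
      refine h2.congr fun j => ?_
      rw [hD, div_eq_mul_inv, div_eq_mul_inv, div_eq_mul_inv,
        ENNReal.mul_inv (Or.inl (hD0 j)) (Or.inl (hDtop j)), mul_assoc]
    have h3 := ENNReal.Tendsto.sub (tendsto_const_nhds (x := (1 : ℝ≥0∞))) h1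
      (Or.inl ENNReal.one_ne_top)
    rw [tsub_zero] at h3
    refine h3.congr fun j => ?_
    have hV0 : volume ((B ^ j) ⁻¹' Metric.ball (0 : Rd d) r) ≠ 0 := by
      rw [hD]; exact mul_ne_zero (hD0 j) hb0
    have hVtop : volume ((B ^ j) ⁻¹' Metric.ball (0 : Rd d) r) ≠ ∞ := by
      rw [hD]; exact ENNReal.mul_ne_top (hDtop j) hbtop
    symm
    refine ENNReal.eq_sub_of_add_eq ?_ ?_
    · exact ENNReal.div_ne_top (ne_top_of_le_ne_top hVtop (measure_mono Set.inter_subset_right)) hV0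
    · rw [← ENNReal.add_div, Set.inter_comm Fᶜ, Set.inter_comm F, ← Set.sdiff_eq,
        add_comm, measure_inter_add_sdiff₀ _ hFmeas, ENNReal.div_self hV0 hVtop]
  refine ⟨Fᶜ, hFmeas.compl, ?_, hdens, ?_⟩
  -- Positive measure follows from density one: some quotient is positive.
  · obtain ⟨j, hj⟩ := ((tendsto_order.1 (hdens 1 one_pos)).1 0 one_pos).exists
    refine lt_of_lt_of_le (pos_iff_ne_zero.2 fun h0 => ?_)
      (measure_mono (Set.inter_subset_left (t := (B ^ j) ⁻¹' Metric.ball (0 : Rd d) 1)))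
    rw [h0, ENNReal.zero_div] at hj
    exact lt_irrefl _ hj
  · have h0 : withValueAtZero σ 0 0 = 0 := Function.update_self _ _ _
    rw [h0, EMetric.tendsto_nhds]
    intro ε hε
    obtain ⟨n, hn⟩ := ENNReal.exists_inv_nat_lt hε.ne'
    have hcn : c n < ε := lt_of_le_of_lt (ENNReal.inv_le_inv.2 le_self_add) hn
    filter_upwards [self_mem_nhdsWithin,
      mem_nhdsWithin_of_mem_nhds (Metric.ball_mem_nhds (0 : Rd d) (hδ0 n))] with ξ hξ hξ'
    by_cases hξ0 : ξ = 0
    · rw [hξ0, h0, edist_self]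
      exact hε
    · rw [withValueAtZero, Function.update_of_ne hξ0, edist_zero_right]
      refine lt_trans (not_le.1 fun hle => hξ (Set.mem_iUnion.2 ⟨n, hle, hξ'⟩)) hcn

end ApproxContinuity

/-! ### Expansive dilations -/

section Expansive

/-- Gelfand's formula: `‖a ^ j‖` is eventually at most `q ^ j` for some `q < 1`. -/
theorem tendsto_pow_zero_of_spectralRadius_lt_one {R : Type*} [NormedRing R] [NormedAlgebra ℂ R]
    [CompleteSpace R] {a : R} (ha : spectralRadius ℂ a < 1) :
    Tendsto (fun j : ℕ => a ^ j) atTop (𝓝 0) := by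
  obtain ⟨q, hq1, hq2⟩ := exists_between ha
  have h1 := (tendsto_order.1 (spectrum.pow_nnnorm_pow_one_div_tendsto_nhds_spectralRadius a)).2
    q hq1
  have h2 : Tendsto (fun j : ℕ => ‖a ^ j‖ₑ) atTop (𝓝 0) := by
    refine tendsto_of_tendsto_of_tendsto_of_le_of_le' tendsto_const_nhds
      (ENNReal.tendsto_pow_atTop_nhds_zero_of_lt_one hq2) (Eventually.of_forall fun _ => zero_le) ?_
    filter_upwards [h1, eventually_ge_atTop 1] with j hj hj1
    have hj0 : (j : ℝ) ≠ 0 := by positivity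
    have h3 := ENNReal.rpow_le_rpow hj.le (Nat.cast_nonneg (α := ℝ) j)
    rw [← ENNReal.rpow_mul, one_div, inv_mul_cancel₀ hj0, ENNReal.rpow_one,
      ENNReal.rpow_natCast] at h3
    exact h3
  rw [tendsto_zero_iff_enorm_tendsto_zero]
  exact h2

variable {d : ℕ}

-- The spectrum of `M = N⁻¹` consists of inverses of eigenvalues of `N`, so it lies in the open unit
-- disc. The norm serves only to invoke Gelfand's formula; the entrywise conclusion does not depend
-- on it.
attribute [local instance] Matrix.linftyOpNormedRing Matrix.linftyOpNormedAlgebra in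
theorem tendsto_pow_matrix_zero {M N : Matrix (Fin d) (Fin d) ℂ} (hNM : N * M = 1)
    (hN : ∀ z, N.charpoly.IsRoot z → 1 < ‖z‖) (i j : Fin d) :
    Tendsto (fun n : ℕ => (M ^ n) i j) atTop (𝓝 0) := by
  have : Nonempty (Fin d) := ⟨i⟩
  have hMN : M * N = 1 := mul_eq_one_comm.1 hNM
  let u : (Matrix (Fin d) (Fin d) ℂ)ˣ := ⟨N, M, hNM, hMN⟩
  have h1 : spectralRadius ℂ M < (1 : NNReal) := by
    refine spectrum.spectralRadius_lt_of_forall_lt _ fun z hz => ?_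
    have h2 : z⁻¹ ∈ spectrum ℂ N := by
      have h3 : z ∈ (spectrum ℂ (u : Matrix (Fin d) (Fin d) ℂ))⁻¹ := by
        rw [spectrum.map_inv]
        exact hz
      exact Set.mem_inv.1 h3
    have h4 := hN _ (Matrix.mem_spectrum_iff_isRoot_charpoly.1 h2)
    rw [norm_inv] at h4
    have h5 : ‖z‖ < 1 := (one_lt_inv_iff₀.1 h4).2
    exact_mod_cast h5
  have h6 := tendsto_pow_zero_of_spectralRadius_lt_one (R := Matrix (Fin d) (Fin d) ℂ)
    (by exact_mod_cast h1)
  have h7 : Continuous fun X : Matrix (Fin d) (Fin d) ℂ => X i j := by fun_prop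
  exact (h7.tendsto 0).comp h6

/-- The eigenvalue condition concerns complex roots, so the matrices are complexified and the limit
is brought back by taking real parts. -/
theorem IsExpansiveDilation.tendsto_pow_inverse {A A' : Rd d →ₗ[ℝ] Rd d}
    (hA : IsExpansiveDilation A) (hAA' : A * A' = 1) (v : Rd d) :
    Tendsto (fun n : ℕ => (A' ^ n) v) atTop (𝓝 0) := by
  set b := (EuclideanSpace.basisFun (Fin d) ℝ).toBasis
  set M := LinearMap.toMatrixAlgEquiv b A' with hM
  set N := LinearMap.toMatrixAlgEquiv b A with hN
  have hNM : N * M = 1 := by rw [hN, hM, ← map_mul, hAA', map_one]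
  have h1 : N.map (algebraMap ℝ ℂ) * M.map (algebraMap ℝ ℂ) = 1 := by
    rw [← Matrix.map_mul, hNM]
    exact Matrix.map_one _ (map_zero _) (map_one _)
  have h2 : ∀ z, (N.map (algebraMap ℝ ℂ)).charpoly.IsRoot z → 1 < ‖z‖ := by
    intro z hz
    refine hA.one_lt_norm z ?_
    rw [Matrix.charpoly_map] at hz
    have : N.charpoly = A.charpoly := LinearMap.charpoly_toMatrix A b
    rwa [this] at hz
  have h3 : ∀ i j, Tendsto (fun n : ℕ => (M ^ n) i j) atTop (𝓝 0) := by
    intro i j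
    have h4 := tendsto_pow_matrix_zero h1 h2 i j
    have h5 : ∀ n : ℕ, (M.map (algebraMap ℝ ℂ) ^ n) i j = (((M ^ n) i j : ℝ) : ℂ) := by
      intro n
      have := (RingHom.mapMatrix (algebraMap ℝ ℂ)).map_pow M n
      exact (congrFun (congrFun this i) j).symm
    simp_rw [h5] at h4
    exact (Complex.continuous_re.tendsto 0).comp h4
  have h6 : ∀ n : ℕ, ∀ i, (A' ^ n) v i = ∑ j, (M ^ n) i j * v j := by
    intro n i
    rw [hM, ← map_pow]
    have := congrFun (LinearMap.toMatrix_mulVec_repr b b (A' ^ n) v) i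
    exact this.symm
  have h7 : Tendsto (fun n : ℕ => ((A' ^ n) v).ofLp) atTop (𝓝 0) := by
    refine tendsto_pi_nhds.2 fun i => ?_
    simp_rw [h6]
    have h8 := tendsto_finsetSum Finset.univ fun j _ => (h3 i j).mul_const (v j)
    simpa using h8
  exact ((PiLp.continuous_toLp 2 fun _ : Fin d => ℝ).tendsto 0).comp h7

/-- Duality gives `ξ i = ⟨A^{-n} e_i, (A^*)^n ξ⟩`, so `|ξ i| ≤ ‖A^{-n} e_i‖ r`, and `A^{-n} e_i →
0`. The cube is centred so that it contains a neighbourhood of the origin. -/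
theorem eventually_preimage_ball_subset_unitCube {A : Rd d →ₗ[ℝ] Rd d}
    (hA : IsExpansiveDilation A) (r : ℝ) :
    ∀ᶠ n : ℕ in atTop, (LinearMap.adjoint A ^ n) ⁻¹' Metric.ball 0 r ⊆
      unitCube (fun _ : Fin d => (-(1 / 2) : ℝ)) := by
  set e := A.equivOfDetNeZero hA.det_ne_zero with he
  set A' : Rd d →ₗ[ℝ] Rd d := e.symm.toLinearMap with hA'
  have hAA' : A * A' = 1 := LinearMap.ext fun x => e.apply_symm_apply x
  have hpow : ∀ n : ℕ, A ^ n * A' ^ n = 1 := by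
    have hcomm : Commute A A' := by
      have : A' * A = 1 := LinearMap.ext fun x => e.symm_apply_apply x
      rw [commute_iff_eq, hAA', this]
    intro n
    rw [← hcomm.mul_pow, hAA', one_pow]
  have h1 : ∀ i : Fin d, ∀ᶠ n : ℕ in atTop,
      ‖(A' ^ n) (EuclideanSpace.single i 1)‖ * r < 1 / 2 := by
    intro i
    have h2 := ((hA.tendsto_pow_inverse hAA' (EuclideanSpace.single i 1)).norm).mul_const r
    rw [norm_zero, zero_mul] at h2
    exact (tendsto_order.1 h2).2 _ (by norm_num)
  filter_upwards [eventually_all.2 h1] with n hn ξ hξ i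
  have h3 : ξ i = inner ℝ ((A' ^ n) (EuclideanSpace.single i 1)) ((LinearMap.adjoint A ^ n) ξ) := by
    have h4 : LinearMap.adjoint A ^ n = LinearMap.adjoint (A ^ n) := by
      rw [← LinearMap.star_eq_adjoint, ← LinearMap.star_eq_adjoint, star_pow]
    rw [h4, LinearMap.adjoint_inner_right, ← Module.End.mul_apply, hpow]
    simp [EuclideanSpace.inner_single_left]
  have h5 : |ξ i| < 1 / 2 := by
    rw [h3]
    refine (abs_real_inner_le_norm _ _).trans_lt (lt_of_le_of_lt ?_ (hn i))
    gcongr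
    exact (mem_ball_zero_iff.1 hξ).le
  rw [abs_lt] at h5
  constructor <;> linarith [h5.1, h5.2]

end Expansive

/-! ### Projections onto mutually orthogonal dilates -/

section Orthogonality

/-- Bessel's inequality for vectors that need not be normalized; `hf` says that `f - v j` is
orthogonal to `v j`. With `S` the partial sum, `‖S‖² = ⟨f, S⟩ ≤ ‖f‖ ‖S‖`. -/
theorem sum_sq_norm_le_of_orthogonal {H J : Type*} [NormedAddCommGroup H] [InnerProductSpace ℂ H]
    (f : H) (v : J → H) (hv : ∀ i j, i ≠ j → inner ℂ (v i) (v j) = 0)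
    (hf : ∀ j, inner ℂ f (v j) = inner ℂ (v j) (v j)) (s : Finset J) :
    ∑ j ∈ s, ‖v j‖ ^ 2 ≤ ‖f‖ ^ 2 := by
  classical
  set S := ∑ j ∈ s, v j with hS
  have h1 : inner ℂ f S = ((∑ j ∈ s, ‖v j‖ ^ 2 : ℝ) : ℂ) := by
    rw [hS, inner_sum]
    push_cast
    exact Finset.sum_congr rfl fun j _ => by rw [hf, inner_self_eq_norm_sq_to_K]; rfl
  have h2 : inner ℂ S S = ((∑ j ∈ s, ‖v j‖ ^ 2 : ℝ) : ℂ) := by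
    rw [← h1, hS, sum_inner, inner_sum]
    refine Finset.sum_congr rfl fun j hj => ?_
    rw [inner_sum, Finset.sum_eq_single_of_mem j hj fun i _ hij => hv j i hij.symm, hf]
  have h3 : ∑ j ∈ s, ‖v j‖ ^ 2 = ‖S‖ ^ 2 := by
    rw [inner_self_eq_norm_sq_to_K] at h2
    exact Complex.ofReal_injective (by rw [← h2]; push_cast; rfl)
  have h4 : ∑ j ∈ s, ‖v j‖ ^ 2 ≤ ‖f‖ * ‖S‖ := by
    have h5 := norm_inner_le_norm (𝕜 := ℂ) f S
    rw [h1, Complex.norm_real] at h5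
    exact (le_abs_self _).trans h5
  rw [h3] at h4 ⊢
  nlinarith [norm_nonneg f, norm_nonneg S, sq_nonneg (‖f‖ - ‖S‖)]

/-- `U^j P U^{-j} f` is the projection of `f` onto `U^j V`. Bessel makes these squared norms
summable, and the isometry `U^j` can be dropped from the norm. -/
theorem tendsto_norm_starProjection_zero {H : Type*} [NormedAddCommGroup H]
    [InnerProductSpace ℂ H] (U : H ≃ₗᵢ[ℂ] H) (V : Submodule ℂ H) [V.HasOrthogonalProjection]
    (hV : ∀ i j : ℕ, i ≠ j → ∀ x ∈ V, ∀ y ∈ V, inner ℂ ((U ^ i) x) ((U ^ j) y) = 0) (f : H) :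
    Tendsto (fun j : ℕ => ‖V.starProjection ((U⁻¹ ^ j) f)‖ ^ 2) atTop (𝓝 0) := by
  have h0 : ∀ j : ℕ, (U ^ j) ((U⁻¹ ^ j) f) = f := fun j => by
    rw [inv_pow]
    exact LinearIsometryEquiv.apply_symm_apply (U ^ j) f
  have h1 : Summable fun j : ℕ => ‖(U ^ j) (V.starProjection ((U⁻¹ ^ j) f))‖ ^ 2 := by
    refine summable_of_sum_le (c := ‖f‖ ^ 2) (fun _ => by positivity)
      (sum_sq_norm_le_of_orthogonal f _ (fun i j hij => ?_) fun j => ?_)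
    · exact hV i j hij _ (V.starProjection_apply_mem _) _ (V.starProjection_apply_mem _)
    · have h2 : inner ℂ f ((U ^ j) (V.starProjection ((U⁻¹ ^ j) f))) =
          inner ℂ ((U ^ j) ((U⁻¹ ^ j) f)) ((U ^ j) (V.starProjection ((U⁻¹ ^ j) f))) := by
        rw [h0]
      rw [h2, LinearIsometryEquiv.inner_map_map, LinearIsometryEquiv.inner_map_map,
        Submodule.inner_starProjection_left_eq_right,
        Submodule.starProjection_eq_self_iff.2 (V.starProjection_apply_mem _)]
  simpa only [LinearIsometryEquiv.norm_map] using h1.tendsto_atTop_zero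

end Orthogonality

-- Dilations of band functions and the theorem

section Main

variable {d : ℕ}

theorem dilation_inv_bandFunction (A : Rd d →ₗ[ℝ] Rd d) (hA : LinearMap.det A ≠ 0)
    {K K' : Set (Rd d)} (hK : MeasurableSet K) (hKt : volume K ≠ ∞) (hK' : MeasurableSet K')
    (hKt' : volume K' ≠ ∞) (hKK' : K' = LinearMap.adjoint A ⁻¹' K) :
    (dilation A hA)⁻¹ (bandFunction hK hKt) =
      ((Real.sqrt |LinearMap.det A| : ℝ) : ℂ) • bandFunction hK' hKt' := by
  have hA' : LinearMap.det (LinearMap.adjoint A) ≠ 0 := by rwa [det_adjoint]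
  set c : ℂ := ((Real.sqrt |LinearMap.det A| : ℝ) : ℂ) with hc
  apply (Lp.fourierTransformₗᵢ (Rd d) ℂ).injective
  change (𝓕 ((dilation A hA)⁻¹ (bandFunction hK hKt)) : L2 d) = 𝓕 (c • bandFunction hK' hKt')
  have h1 : dilation A hA ((dilation A hA)⁻¹ (bandFunction hK hKt)) = bandFunction hK hKt :=
    LinearIsometryEquiv.apply_symm_apply (dilation A hA) _
  rw [← dilation_adjoint_fourier_dilation A hA hA', h1, FourierTransform.fourier_smul,
    fourier_bandFunction, fourier_bandFunction]
  apply Lp.ext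
  filter_upwards [dilation_apply_ae _ hA' (indicatorConstLp 2 hK hKt (1 : ℂ)),
    (quasiMeasurePreserving_linearMap hA').ae
      (indicatorConstLp_coeFn (p := 2) (hs := hK) (hμs := hKt) (c := (1 : ℂ))),
    indicatorConstLp_coeFn (p := 2) (hs := hK') (hμs := hKt') (c := (1 : ℂ)),
    Lp.coeFn_smul c (indicatorConstLp 2 hK' hKt' (1 : ℂ))] with ξ h2 h3 h4 h5
  rw [h2, h3, h5, Pi.smul_apply, h4, det_adjoint, smul_eq_mul, hKK']
  rfl

theorem dilation_inv_pow_bandFunction (A : Rd d →ₗ[ℝ] Rd d) (hA : LinearMap.det A ≠ 0)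
    {K : Set (Rd d)} (hK : MeasurableSet K) (hKt : volume K ≠ ∞)
    (hK' : ∀ j : ℕ, MeasurableSet ((LinearMap.adjoint A ^ j) ⁻¹' K))
    (hKt' : ∀ j : ℕ, volume ((LinearMap.adjoint A ^ j) ⁻¹' K) ≠ ∞) (j : ℕ) :
    ((dilation A hA)⁻¹ ^ j) (bandFunction hK hKt) =
      ((Real.sqrt |LinearMap.det A| : ℝ) : ℂ) ^ j • bandFunction (hK' j) (hKt' j) := by
  induction j with
  | zero => simp
  | succ j ih =>
    have h1 : (LinearMap.adjoint A ^ (j + 1)) ⁻¹' K =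
        LinearMap.adjoint A ⁻¹' ((LinearMap.adjoint A ^ j) ⁻¹' K) := by
      rw [pow_succ]
      rfl
    have h2 : ((dilation A hA)⁻¹ ^ (j + 1)) (bandFunction hK hKt) =
        (dilation A hA)⁻¹ (((dilation A hA)⁻¹ ^ j) (bandFunction hK hKt)) := by
      rw [pow_succ']
      rfl
    rw [h2, ih, map_smul,
      dilation_inv_bandFunction A hA (hK' j) (hKt' j) (hK' (j + 1)) (hKt' (j + 1)) h1,
      smul_smul, ← pow_succ]

end Main

end ShiftInvariant

open ShiftInvariant in
theorem mainTheorem4 (d : ℕ) (hd : 1 ≤ d)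
    (A : ShiftInvariant.Rd d →ₗ[ℝ] ShiftInvariant.Rd d)
    (hA : ShiftInvariant.IsExpansiveDilation A)
    (G : Set (ShiftInvariant.Rd d)) (hGmeas : NullMeasurableSet G volume)
    (hG : LinearMap.adjoint A '' G = G)
    (W : Submodule ℂ (ShiftInvariant.L2 d)) (hW : ShiftInvariant.IsShiftInvariant W)
    (hsum : ShiftInvariant.IsOrthogonalSum (ShiftInvariant.H2 G)
      (fun j : ℤ => ShiftInvariant.dilate A hA.det_ne_zero j W)) :
    (∃ σ : ShiftInvariant.Rd d → ℝ, ShiftInvariant.IsSpectralFunction W σ) ∧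
    ∀ σ : ShiftInvariant.Rd d → ℝ, ShiftInvariant.IsSpectralFunction W σ →
      ShiftInvariant.IsApproxContinuousAtZero (LinearMap.adjoint A)
        (ShiftInvariant.withValueAtZero σ 0) := by
  have : CompleteSpace W := hW.isClosed.completeSpace_coe
  refine ⟨exists_isSpectralFunction hW, fun σ hσ => ?_⟩
  have hdet := hA.det_ne_zero
  have hdet' : LinearMap.det (LinearMap.adjoint A) ≠ 0 := by rwa [det_adjoint]
  refine isApproxContinuousAtZero_of_tendsto_average hd hdet' hσ.aemeasurable fun r hr => ?_
  have hK : ∀ j : ℕ, MeasurableSet ((LinearMap.adjoint A ^ j) ⁻¹' Metric.ball (0 : Rd d) r) :=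
    fun j => measurableSet_preimage_pow _ j measurableSet_ball
  have hKt : ∀ j : ℕ, volume ((LinearMap.adjoint A ^ j) ⁻¹' Metric.ball (0 : Rd d) r) ≠ ∞ :=
    fun j => by
      rw [volume_preimage_pow hdet']
      exact ENNReal.mul_ne_top ENNReal.ofReal_ne_top measure_ball_lt_top.ne
  set f : L2 d := bandFunction (measurableSet_ball (x := (0 : Rd d)) (ε := r))
    measure_ball_lt_top.ne with hf
  have horth : ∀ i j : ℕ, i ≠ j → ∀ x ∈ W, ∀ y ∈ W,
      inner ℂ ((dilation A hdet ^ i) x) ((dilation A hdet ^ j) y) = 0 := by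
    intro i j hij x hx y hy
    have h1 := hsum.1 (i : ℤ) (j : ℤ) (by exact_mod_cast hij)
    refine h1.inner_eq ⟨x, hx, ?_⟩ ⟨y, hy, ?_⟩
    · rw [zpow_natCast]; rfl
    · rw [zpow_natCast]; rfl
  have hlim := tendsto_norm_starProjection_zero (dilation A hdet) W horth f
  have hlim' := (ENNReal.continuous_ofReal.tendsto 0).comp hlim
  rw [ENNReal.ofReal_zero] at hlim'
  refine hlim'.congr' ?_
  -- The squared norm of the scalar `|det A|^{j/2}` picked up by `D_A^{-j} f` is `|det A|^j`,
  -- exactly the reciprocal of the Jacobian dividing the integral.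
  filter_upwards [eventually_preimage_ball_subset_unitCube hA r] with j hj
  have hpos : 0 < |LinearMap.det A| := abs_pos.2 hdet
  rw [hσ.setLIntegral_enorm hW (hK j) (hKt j) hj, Function.comp_apply, hf,
    dilation_inv_pow_bandFunction A hdet _ _ hK hKt, map_smul, norm_smul, mul_pow, norm_pow,
    Complex.norm_real, Real.norm_of_nonneg (Real.sqrt_nonneg _), ← pow_mul, mul_comm j 2, pow_mul,
    Real.sq_sqrt hpos.le, ENNReal.ofReal_mul (by positivity), ENNReal.ofReal_pow (norm_nonneg _),
    ofReal_norm, det_adjoint, abs_inv, abs_pow, ENNReal.ofReal_inv_of_pos (by positivity),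
    div_eq_mul_inv, inv_inv, mul_comm]
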